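/- Let $m$ be a positive integer, let $F=\mathbb{F}_{2^m}$ be the finite field with $2^m$ elements, let $F^*=F\setminus\{0\}$, and let $\mathrm{Tr}$ denote the trace function of $F$ over $\mathbb{F}_2$. For $a\in F$ let $$K(a)=\sum_{x\in F^*}(-1)^{\mathrm{Tr}(ax+1/x)}$$ be the Kloosterman sum. Then for every $a\in F\setminus\{0,1\}$: (1) (Helleseth–Zinoviev Formula I) $K\bigl(a^3(a+1)\bigr)=K\bigl(a(a+1)^3\bigr)$; (3) (Hollmann–Xiang Formula) $K\bigl(a^8(a^4+a)\bigr)=K\bigl((a+1)^8(a^4+a)\bigr)$. -/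

import Mathlib

/-- The Kloosterman sum `K(a) = ∑_{x ∈ F, x ≠ 0} (-1)^{Tr(a x + 1/x)}` over a finite field `F` of
characteristic two, where `Tr` is the trace of `F` over its prime field `ZMod 2`. The formula is
used for all `a`, including `a = 0`. -/
noncomputable def kloostermanSum {F : Type*} [Field F] [Fintype F] [DecidableEq F]
    [Algebra (ZMod 2) F] (a : F) : ℤ :=
  ∑ x ∈ Finset.univ.filter (fun x : F => x ≠ 0),
    (-1 : ℤ) ^ (Algebra.trace (ZMod 2) F (a * x + 1 / x)).val

/-! With ψ the trace sign, K(b) = ∑ ψ(x + b/x). The cubic map R sends x + b/x to the corresponding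
expression for b' up to terms z² + z, invisible to ψ, so K(b) can be summed over fibres of R. A
fibre over y is the root set of a cubic, which has exactly one root when its resolvent has none; the
trace shows this happens whenever ψ(y + b'/y) ≠ ψ(s). Only values equal to ψ(s) are thus miscounted,
and a count of points gives the error: it cancels the zero and pole left out. The second formula
follows by taking s = x³, where one side becomes a function of x⁴ + x, invariant under x ↦ x + 1. -/

/-- The additive character `x ↦ (-1)^{Tr x}` of a finite field of characteristic two. -/
noncomputable def traceSign {F : Type*} [Field F] [Algebra (ZMod 2) F] (x : F) : ℤ :=
  (-1 : ℤ) ^ (Algebra.trace (ZMod 2) F x).val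

/-- A root of the quadratic resolvent of the cubic with roots `r`, `s`, `r + s`. -/
theorem cubic_resolvent {K : Type*} [Field K] [CharP K 2] {p q r s : K} (hrs : r ≠ s)
    (hr : r ^ 3 + p * r + q = 0) (hs : s ^ 3 + p * s + q = 0) :
    p = r ^ 2 + r * s + s ^ 2 ∧ q = r * s * (r + s) ∧
    (r ^ 3 + r ^ 2 * s + s ^ 3) ^ 2 + q * (r ^ 3 + r ^ 2 * s + s ^ 3) = p ^ 3 + q ^ 2 := by
  have h2 : (2 : K) = 0 := CharTwo.two_eq_zero
  have hp : p = r ^ 2 + r * s + s ^ 2 := by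
    have h : (r - s) * (p + (r ^ 2 + r * s + s ^ 2)) = 0 := by linear_combination hr - hs
    have h' := (mul_eq_zero.mp h).resolve_left (sub_ne_zero.mpr hrs)
    linear_combination h' - (r ^ 2 + r * s + s ^ 2) * h2
  have hq : q = r * s * (r + s) := by
    rw [hp] at hr
    linear_combination hr - (r ^ 3 + r ^ 2 * s + r * s ^ 2) * h2
  refine ⟨hp, hq, ?_⟩
  rw [hp, hq]
  grind

theorem trace_sq_add_self {F : Type*} [Field F] [Finite F] [Algebra (ZMod 2) F] (z : F) :
    Algebra.trace (ZMod 2) F (z ^ 2 + z) = 0 := by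
  have h := Algebra.trace_eq_of_algEquiv (FiniteField.frobeniusAlgEquivOfAlgebraic (ZMod 2) F) z
  have h' : FiniteField.frobeniusAlgEquivOfAlgebraic (ZMod 2) F z = z ^ 2 := by
    simp
  rw [h'] at h
  rw [map_add, h, CharTwo.add_self_eq_zero]

theorem traceSign_add {F : Type*} [Field F] [Algebra (ZMod 2) F] (x y : F) :
    traceSign (x + y) = traceSign x * traceSign y := by
  unfold traceSign
  rw [map_add]
  generalize Algebra.trace (ZMod 2) F x = u
  generalize Algebra.trace (ZMod 2) F y = v
  revert u v
  decide

theorem traceSign_sq_add_self {F : Type*} [Field F] [Finite F] [Algebra (ZMod 2) F] (z : F) :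
    traceSign (z ^ 2 + z) = 1 := by
  simp [traceSign, trace_sq_add_self]

theorem traceSign_eq_or {F : Type*} [Field F] [Algebra (ZMod 2) F] (x : F) :
    traceSign x = 1 ∨ traceSign x = -1 :=
  neg_one_pow_eq_or ℤ _

theorem mem_range_algebraMap_of_pow_card_eq {F K : Type*} [Field F] [Fintype F] [Field K]
    [Algebra F K] {x : K} (hx : x ^ Fintype.card F = x) : ∃ y : F, algebraMap F K y = x := by
  have h : (Polynomial.X ^ Fintype.card F - Polynomial.X : Polynomial K) =
      (∏ y : F, (Polynomial.X - Polynomial.C y)).map (algebraMap F K) := by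
    have hmonic : (Polynomial.X ^ Fintype.card F - Polynomial.X : Polynomial F).Monic :=
      Polynomial.monic_X_pow_sub (by
        rw [Polynomial.degree_X]
        exact_mod_cast Fintype.one_lt_card)
    have hprod := Polynomial.prod_multiset_X_sub_C_of_monic_of_roots_card_eq hmonic (by
      rw [FiniteField.roots_X_pow_card_sub_X,
        FiniteField.X_pow_card_sub_X_natDegree_eq F Fintype.one_lt_card]
      rfl)
    rw [FiniteField.roots_X_pow_card_sub_X] at hprod
    change ∏ y : F, (Polynomial.X - Polynomial.C y) = _ at hprod
    rw [hprod]
    simp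
  have h' := congrArg (Polynomial.eval x) h
  rw [Polynomial.map_prod, Polynomial.eval_prod] at h'
  simp only [Polynomial.eval_sub, Polynomial.eval_pow, Polynomial.eval_X, hx, sub_self,
    Polynomial.map_sub, Polynomial.map_X, Polynomial.map_C, Polynomial.eval_C] at h'
  obtain ⟨y, -, hy⟩ := Finset.prod_eq_zero_iff.mp h'.symm
  exact ⟨y, (sub_eq_zero.mp hy).symm⟩

/-- If the cubic `z ^ 3 + p z + q` has no root, its quadratic resolvent has one. -/
theorem exists_resolvent_root {F : Type*} [Field F] [Fintype F] [CharP F 2] {p q : F}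
    (hno : ∀ z : F, z ^ 3 + p * z + q ≠ 0) : ∃ w : F, w ^ 2 + q * w = p ^ 3 + q ^ 2 := by
  let K := AlgebraicClosure F
  have : CharP K 2 := charP_of_injective_algebraMap (algebraMap F K).injective 2
  have h2 : (2 : K) = 0 := CharTwo.two_eq_zero
  let σ : K →ₐ[F] K := FiniteField.frobeniusAlgHom F K
  have hσ : ∀ x : K, σ x = x → ∃ y : F, algebraMap F K y = x := fun x hx =>
    mem_range_algebraMap_of_pow_card_eq (by simpa [σ, FiniteField.coe_frobeniusAlgHom] using hx)
  set P := algebraMap F K p with hP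
  set Q := algebraMap F K q with hQ
  have hroot : ∀ x : K, x ^ 3 + P * x + Q = 0 → σ x ≠ x := by
    intro x hx hfix
    obtain ⟨y, rfl⟩ := hσ x hfix
    refine hno y ((algebraMap F K).injective ?_)
    simpa [hP, hQ] using hx
  have hmap : ∀ x : K, x ^ 3 + P * x + Q = 0 → (σ x) ^ 3 + P * σ x + Q = 0 := by
    intro x hx
    simpa [hP, hQ] using congrArg σ hx
  obtain ⟨r, hr⟩ : ∃ r : K, r ^ 3 + P * r + Q = 0 := by
    have hdeg : (Polynomial.X ^ 3 + Polynomial.C P * Polynomial.X + Polynomial.C Q).degree = 3 := by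
      compute_degree!
    obtain ⟨r, hr⟩ := IsAlgClosed.exists_root
      (Polynomial.X ^ 3 + Polynomial.C P * Polynomial.X + Polynomial.C Q) (by rw [hdeg]; decide)
    exact ⟨r, by simpa [Polynomial.IsRoot] using hr⟩
  obtain ⟨s, hs⟩ : ∃ s, s = σ r := ⟨_, rfl⟩
  obtain ⟨t, ht⟩ : ∃ t, t = σ s := ⟨_, rfl⟩
  have hsr : r ≠ s := by rw [hs]; exact (hroot r hr).symm
  have hsroot : s ^ 3 + P * s + Q = 0 := by rw [hs]; exact hmap r hr
  have htroot : t ^ 3 + P * t + Q = 0 := by rw [ht]; exact hmap s hsroot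
  have hts : t ≠ s := by rw [ht]; exact hroot s hsroot
  obtain ⟨hp, hq, hres⟩ := cubic_resolvent hsr hr hsroot
  have htrs : t = r + s := by
    have hprod : (t - r) * ((t - s) * (t - (r + s))) = 0 := by
      rw [hp, hq] at htroot
      linear_combination htroot + (-(r + s) * t ^ 2 + r * s * t - r * s * (r + s)) * h2
    rcases mul_eq_zero.mp hprod with h | h
    -- Frobenius would swap `r` and `s`, hence fix the third root `r + s`.
    · exfalso
      have htr : σ s = r := by rw [← ht]; exact sub_eq_zero.mp h
      refine hroot (r + s) ?_ (by rw [map_add, htr, ← hs, add_comm])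
      rw [hp, hq]
      linear_combination (r + s) ^ 3 * h2
    · exact sub_eq_zero.mp ((mul_eq_zero.mp h).resolve_left (sub_ne_zero.mpr hts))
  -- Frobenius cycles r → s → r + s, and this expression is invariant under that 3-cycle.
  obtain ⟨w, hw⟩ := hσ (r ^ 3 + r ^ 2 * s + s ^ 3) (by
    simp only [map_add, map_mul, map_pow, ← hs, ← ht, htrs]
    linear_combination (s ^ 3 + 2 * r * s ^ 2 + r ^ 2 * s) * h2)
  refine ⟨w, (algebraMap F K).injective ?_⟩
  rw [← hw] at hres
  simpa [hP, hQ] using hres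

/-- A cubic over a finite field of characteristic two whose quadratic resolvent is irreducible has
exactly one root. -/
theorem existsUnique_cubic_root {F : Type*} [Field F] [Fintype F] [Algebra (ZMod 2) F] {p q : F}
    (hq : q ≠ 0) (hsign : traceSign (p ^ 3 / q ^ 2 + 1) = -1) :
    ∃! z : F, z ^ 3 + p * z + q = 0 := by
  have : CharP F 2 := charP_of_injective_algebraMap (algebraMap (ZMod 2) F).injective 2
  have key : ∀ w : F, w ^ 2 + q * w ≠ p ^ 3 + q ^ 2 := by
    intro w hw
    -- Dividing the resolvent by q² puts it in Artin–Schreier form.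
    have h : p ^ 3 / q ^ 2 + 1 = (w / q) ^ 2 + w / q := by
      field_simp
      linear_combination -hw
    rw [h, traceSign_sq_add_self] at hsign
    norm_num at hsign
  obtain ⟨z, hz⟩ : ∃ z : F, z ^ 3 + p * z + q = 0 := by
    by_contra! hno
    obtain ⟨w, hw⟩ := exists_resolvent_root hno
    exact key w hw
  refine ⟨z, hz, fun w hw => ?_⟩
  by_contra hne
  exact key _ (cubic_resolvent hne hw hz).2.2

theorem kloostermanSum_eq_sum_traceSign {F : Type*} [Field F] [Fintype F] [DecidableEq F]
    [Algebra (ZMod 2) F] (b : F) :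
    kloostermanSum b = ∑ x ∈ Finset.univ.filter (fun x : F => x ≠ 0), traceSign (x + b / x) := by
  unfold kloostermanSum traceSign
  refine Finset.sum_nbij' (fun x => x⁻¹) (fun x => x⁻¹) ?_ ?_ ?_ ?_ ?_ <;>
    simp [div_eq_mul_inv, add_comm]

/-- The Helleseth–Zinoviev identity, from the `x`-coordinate map
`x ↦ x (x + s ^ 2 + s) ^ 2 / (x + s ^ 2) ^ 2` of an isogeny of degree three. -/
theorem kloostermanSum_cube_mul_add_one {F : Type*} [Field F] [Fintype F] [DecidableEq F]
    [Algebra (ZMod 2) F] (s : F) (hs0 : s ≠ 0) (hs1 : s ≠ 1) :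
    kloostermanSum (s ^ 3 * (s + 1)) = kloostermanSum (s * (s + 1) ^ 3) := by
  have : CharP F 2 := charP_of_injective_algebraMap (algebraMap (ZMod 2) F).injective 2
  have h2 : (2 : F) = 0 := CharTwo.two_eq_zero
  have hs1' : s + 1 ≠ 0 := fun h => hs1 (CharTwo.add_eq_zero.mp h)
  rw [kloostermanSum_eq_sum_traceSign, kloostermanSum_eq_sum_traceSign]
  obtain ⟨c, hc⟩ : ∃ c, c = s * (s + 1) := ⟨_, rfl⟩
  have hc0 : c ≠ 0 := by rw [hc]; exact mul_ne_zero hs0 hs1'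
  have hcs : c ≠ s ^ 2 := fun h => hs0 (by linear_combination h - hc)
  have hss0 : s ^ 2 ≠ 0 := pow_ne_zero 2 hs0
  set S := Finset.univ.filter (fun x : F => x ≠ 0) with hS
  -- Removes the pole `s ^ 2` and the nonzero root `c` of `R`.
  set D := (S.erase (s ^ 2)).erase c with hD
  have hmemD : ∀ x, x ∈ D ↔ x ≠ c ∧ x ≠ s ^ 2 ∧ x ≠ 0 := by simp [hD, hS]
  have hsS : s ^ 2 ∈ S := by simp [hS, hs0]
  have hcS : c ∈ S.erase (s ^ 2) := by simp [hS, hc0, hcs]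
  let R : F → F := fun x => x * (x + c) ^ 2 / (x + s ^ 2) ^ 2
  have hne : ∀ x ∈ D, x ≠ 0 ∧ x + c ≠ 0 ∧ x + s ^ 2 ≠ 0 := by
    intro x hx
    obtain ⟨h1, h3, h4⟩ := (hmemD x).mp hx
    exact ⟨h4, fun h => h1 (CharTwo.add_eq_zero.mp h), fun h => h3 (CharTwo.add_eq_zero.mp h)⟩
  have hR : ∀ x ∈ D, R x ∈ S := by
    intro x hx
    obtain ⟨h1, h3, h4⟩ := hne x hx
    simp only [hS, Finset.mem_filter, Finset.mem_univ, true_and, R]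
    positivity
  have hsign : ∀ x ∈ D, traceSign (x + s ^ 3 * (s + 1) / x) =
      traceSign (R x + s * (s + 1) ^ 3 / R x) := by
    intro x hx
    obtain ⟨h1, h3, h4⟩ := hne x hx
    have e : R x + s * (s + 1) ^ 3 / R x = x + s ^ 3 * (s + 1) / x +
        ((s ^ 2 / (x + s ^ 2)) ^ 2 + s ^ 2 / (x + s ^ 2)) + ((c / (x + c)) ^ 2 + c / (x + c)) := by
      have e1 : R x = x + ((s ^ 2 / (x + s ^ 2)) ^ 2 + s ^ 2 / (x + s ^ 2)) := by
        simp only [R]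
        field_simp
        rw [hc]
        grind
      have e2 : s * (s + 1) ^ 3 / R x =
          s ^ 3 * (s + 1) / x + ((c / (x + c)) ^ 2 + c / (x + c)) := by
        simp only [R]
        field_simp
        rw [hc]
        grind
      rw [e2, e1]
      ring
    rw [e]
    simp only [traceSign_add _ (_ ^ 2 + _), traceSign_sq_add_self, mul_one]
  -- The shift z = x + y kills the quadratic term of the fibre equation.
  have hfib : ∀ x y, y ≠ 0 → ((x ∈ D ∧ R x = y) ↔
      (x + y) ^ 3 + (y + c) ^ 2 * (x + y) + y * s ^ 2 = 0) := by
    intro x y hy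
    have e : (x + y) ^ 3 + (y + c) ^ 2 * (x + y) + y * s ^ 2 =
        x * (x + c) ^ 2 + y * (x + s ^ 2) ^ 2 := by
      rw [hc]
      grind
    rw [e]
    constructor
    · rintro ⟨hx, rfl⟩
      obtain ⟨h1, h3, h4⟩ := hne x hx
      simp only [R]
      field_simp
      linear_combination x * (x + c) ^ 2 * h2
    · intro h
      have hx : x ∈ D := by
        rw [hmemD]
        refine ⟨?_, ?_, ?_⟩
        · rintro rfl
          rw [CharTwo.add_self_eq_zero] at h
          have : x + s ^ 2 ≠ 0 := fun h' => hcs (CharTwo.add_eq_zero.mp h')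
          exact absurd h (by simp [hy, this])
        · rintro rfl
          rw [CharTwo.add_self_eq_zero] at h
          have : s ^ 2 + c ≠ 0 := fun h' => hcs (CharTwo.add_eq_zero.mp h').symm
          exact absurd h (by simp [hs0, this])
        · rintro rfl
          exact absurd h (by simp [hs0, hy])
      refine ⟨hx, ?_⟩
      obtain ⟨h1, h3, h4⟩ := hne x hx
      simp only [R]
      rw [div_eq_iff (pow_ne_zero 2 h4)]
      exact CharTwo.add_eq_zero.mp h
  have hcard : ∀ y ∈ S, traceSign (y + s * (s + 1) ^ 3 / y) ≠ traceSign s →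
      (D.filter (fun x => R x = y)).card = 1 := by
    intro y hy hne'
    have hy0 : y ≠ 0 := by simpa [hS] using hy
    have hq : y * s ^ 2 ≠ 0 := mul_ne_zero hy0 hss0
    have hu : traceSign (((y + c) ^ 2) ^ 3 / (y * s ^ 2) ^ 2 + 1) = -1 := by
      have e : ((y + c) ^ 2) ^ 3 / (y * s ^ 2) ^ 2 + 1 = (y + s * (s + 1) ^ 3 / y) + s +
          (((y + c) ^ 3 / (y * s ^ 2)) ^ 2 + (y + c) ^ 3 / (y * s ^ 2)) +
          ((y / s) ^ 2 + y / s) + (s ^ 2 + s) := by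
        rw [hc]
        field_simp
        grind
      rw [e]
      simp only [traceSign_add _ (_ ^ 2 + _), traceSign_sq_add_self, mul_one]
      rw [traceSign_add]
      rcases traceSign_eq_or s with h | h <;>
        rcases traceSign_eq_or (y + s * (s + 1) ^ 3 / y) with h' | h' <;>
        simp [h, h'] at hne' ⊢
    obtain ⟨z, hz, huniq⟩ := existsUnique_cubic_root hq hu
    rw [Finset.card_eq_one]
    refine ⟨z + y, ?_⟩
    ext x
    rw [Finset.mem_filter, hfib x y hy0, Finset.mem_singleton]
    constructor
    · intro h
      rw [← huniq _ h, add_assoc, CharTwo.add_self_eq_zero, add_zero]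
    · rintro rfl
      rw [add_assoc z, CharTwo.add_self_eq_zero, add_zero]
      exact hz
  have hsum : ∑ x ∈ D, traceSign (x + s ^ 3 * (s + 1) / x) =
      ∑ y ∈ S, ((D.filter (fun x => R x = y)).card : ℤ) * traceSign (y + s * (s + 1) ^ 3 / y) := by
    rw [Finset.sum_congr rfl hsign, ← Finset.sum_fiberwise_of_maps_to hR]
    refine Finset.sum_congr rfl fun y _ => ?_
    rw [Finset.sum_congr rfl (g := fun _ => traceSign (y + s * (s + 1) ^ 3 / y))
      (fun x hx => by rw [(Finset.mem_filter.mp hx).2]), Finset.sum_const, nsmul_eq_mul]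
  -- Fibres of size one cancel; every other y has sign ψ(s), which factors out.
  have hdiff : ∑ y ∈ S, ((D.filter (fun x => R x = y)).card : ℤ) *
        traceSign (y + s * (s + 1) ^ 3 / y) - ∑ y ∈ S, traceSign (y + s * (s + 1) ^ 3 / y) =
      ((D.card : ℤ) - S.card) * traceSign s := by
    rw [Finset.card_eq_sum_card_fiberwise hR, Finset.card_eq_sum_ones S]
    push_cast
    rw [← Finset.sum_sub_distrib, ← Finset.sum_sub_distrib, Finset.sum_mul]
    refine Finset.sum_congr rfl fun y hy => ?_
    by_cases h : traceSign (y + s * (s + 1) ^ 3 / y) = traceSign s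
    · rw [h]
      ring
    · rw [hcard y hy h]
      simp
  have hDcard : (D.card : ℤ) - S.card = -2 := by
    have h1 := Finset.card_erase_add_one hcS
    have h3 := Finset.card_erase_add_one hsS
    rw [← hD] at h1
    omega
  -- Both omitted points contribute ψ(s), making up for the deficit -2ψ(s).
  have hv1 : s ^ 2 + s ^ 3 * (s + 1) / s ^ 2 = s := by
    field_simp
    grind
  have hv2 : c + s ^ 3 * (s + 1) / c = s := by
    rw [hc]
    field_simp
    grind
  have hK := Finset.add_sum_erase S (fun x => traceSign (x + s ^ 3 * (s + 1) / x)) hsS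
  have hK' := Finset.add_sum_erase _ (fun x => traceSign (x + s ^ 3 * (s + 1) / x)) hcS
  rw [← hD] at hK'
  simp only [hv1, hv2] at hK hK'
  rw [hDcard] at hdiff
  linarith

theorem theorem3 {F : Type*} [Field F] [Fintype F] [DecidableEq F] [Algebra (ZMod 2) F]
    (a : F) (ha0 : a ≠ 0) (ha1 : a ≠ 1) :
    kloostermanSum (a ^ 3 * (a + 1)) = kloostermanSum (a * (a + 1) ^ 3) ∧
    kloostermanSum (a ^ 8 * (a ^ 4 + a)) = kloostermanSum ((a + 1) ^ 8 * (a ^ 4 + a)) := by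
  refine ⟨kloostermanSum_cube_mul_add_one a ha0 ha1, ?_⟩
  have : CharP F 2 := charP_of_injective_algebraMap (algebraMap (ZMod 2) F).injective 2
  have h2 : (2 : F) = 0 := CharTwo.two_eq_zero
  have hshift : (a + 1) ^ 4 + (a + 1) = a ^ 4 + a := by grind
  have key : ∀ x : F, x ≠ 0 →
      kloostermanSum (x ^ 8 * (x ^ 4 + x)) = kloostermanSum ((x ^ 4 + x) ^ 3) := by
    intro x hx
    -- Here s = x³ = 1 is excluded from the first formula, but both arguments vanish.
    by_cases h : x ^ 3 = 1
    · have : x ^ 4 + x = 0 := by grind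
      simp [this]
    · convert kloostermanSum_cube_mul_add_one (x ^ 3) (pow_ne_zero 3 hx) h using 2 <;> ring
  have ha1' : a + 1 ≠ 0 := fun h => ha1 (CharTwo.add_eq_zero.mp h)
  have h := key (a + 1) ha1'
  rw [hshift] at h
  rw [key a ha0, h]
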